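/- Let $G$ be a finite-dimensional (real, smooth) Lie group with Lie algebra $\mathcal G = T_1G$, equipped with a bi-invariant pseudo-Riemannian metric $\langle\ ,\ \rangle$ (in particular, this includes bi-invariant Riemannian metrics). Let $\nabla$ be the Levi-Civita covariant derivative and $R$ its Riemannian curvature, $R(X,Y)Z=\nabla_X\nabla_YZ-\nabla_Y\nabla_XZ-\nabla_{[X,Y]}Z$. For $t_0<t_1$, a $C^\infty$ curve $x:[t_0,t_1]\to G$ is called a Riemannian cubic when $$\nabla_t^3x^{(1)}+R_{x(t)}(\nabla_tx^{(1)},x^{(1)})x^{(1)}=\mathbf 0\qquad\text{for all } t\in[t_0,t_1],$$ which is the Euler–Lagrange equation of $J(x)=\int_{t_0}^{t_1}\langle\nabla_tx^{(1)},\nabla_tx^{(1)}\rangle\,dt$ for prescribed values of $x$ and $x^{(1)}$ at $t_0,t_1$. Let $y,z:[t_0,t_1]\to G$ be restrictions of $1$-parameter subgroups of $G$ with infinitesimal generators $A,B\in\mathcal G$, namely $y(t)=\exp(tA)$ and $z(t)=\exp(tB)$. Then the pointwise product $t\mapsto y(t)z(t)$ is a Riemannian cubic if and only if $[[[B,A],A],B]=\mathbf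 0$. -/

import Mathlib

open Set Bundle Manifold
open scoped Manifold ContDiff

noncomputable section

/-- A smooth pseudo-Riemannian metric on a manifold `M`: a smooth family of nondegenerate symmetric
bilinear forms on the tangent spaces. Riemannian metrics are the positive definite ones. -/
structure PseudoRiemannianMetric {E : Type*} [NormedAddCommGroup E] [NormedSpace ℝ E]
    {H : Type*} [TopologicalSpace H] (I : ModelWithCorners ℝ E H)
    (M : Type*) [TopologicalSpace M] [ChartedSpace H M] [IsManifold I ∞ M] where
  /-- The bilinear form on each tangent space. -/
  val : ∀ p : M, TangentSpace I p →L[ℝ] TangentSpace I p →L[ℝ] ℝ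
  symm : ∀ (p : M) (v w : TangentSpace I p), val p v w = val p w v
  nondegenerate : ∀ (p : M) (v : TangentSpace I p), (∀ w, val p v w = 0) → v = 0
  contMDiff : ContMDiff I (I.prod 𝓘(ℝ, E →L[ℝ] E →L[ℝ] ℝ)) ∞
    (fun p ↦ TotalSpace.mk' (E →L[ℝ] E →L[ℝ] ℝ)
      (E := fun p : M ↦ TangentSpace I p →L[ℝ] TangentSpace I p →L[ℝ] ℝ) p (val p))

section Manifold

variable {E : Type*} [NormedAddCommGroup E] [NormedSpace ℝ E]
  {H : Type*} [TopologicalSpace H] {I : ModelWithCorners ℝ E H}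
  {M : Type*} [TopologicalSpace M] [ChartedSpace H M] [IsManifold I ∞ M]

/-- Coordinates, with respect to the preferred chart at `p`, of a tangent vector at `q`
(where `q` lies in the domain of that chart). -/
def toCoord (I : ModelWithCorners ℝ E H) [IsManifold I ∞ M] (p q : M) :
    TangentSpace I q →L[ℝ] E :=
  (trivializationAt E (TangentSpace I : M → Type _) p).continuousLinearMapAt ℝ q

/-- The tangent vector at `q` with given coordinates in the preferred chart at `p`
(where `q` lies in the domain of that chart). -/
def ofCoord (I : ModelWithCorners ℝ E H) [IsManifold I ∞ M] (p q : M) :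
    E →L[ℝ] TangentSpace I q :=
  (trivializationAt E (TangentSpace I : M → Type _) p).symmL ℝ q

namespace PseudoRiemannianMetric

/-- The coordinate expression of the metric in the chart at `p`, at the coordinate point `y`;
it sends `u, v` to the inner product of the tangent vectors with coordinates `u, v`. -/
def inChart (g : PseudoRiemannianMetric I M) (p : M) (y : E) : E →L[ℝ] E →L[ℝ] ℝ :=
  let q : M := (extChartAt I p).symm y
  (ContinuousLinearMap.precomp ℝ (ofCoord I p q)).comp ((g.val q).comp (ofCoord I p q))

/-- The Christoffel symbols of the Levi-Civita connection in the chart at `p`, on a manifold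
without boundary: `christoffel g p y u v` is the vector `Γ` determined by
`g_y (Γ, w) = ((D_u g)_y (v, w) + (D_v g)_y (u, w) - (D_w g)_y (u, v)) / 2` for all `w`. -/
def christoffel (g : PseudoRiemannianMetric I M) (p : M) (y u v : E) : E :=
  (g.inChart p y).inverse
    ((1 / 2 : ℝ) • (fderiv ℝ (g.inChart p) y u v + fderiv ℝ (g.inChart p) y v u
      - ((fderiv ℝ (g.inChart p) y).flip u).flip v))

/-- The Riemann curvature tensor `R_p(u, v) w` of the Levi-Civita connection, with the convention
`R(X, Y) Z = ∇_X ∇_Y Z - ∇_Y ∇_X Z - ∇_[X, Y] Z`, computed in the chart at `p`. -/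
def curvature (g : PseudoRiemannianMetric I M) (p : M) (u v w : TangentSpace I p) :
    TangentSpace I p :=
  let y : E := extChartAt I p p
  let Γ : E → E → E → E := g.christoffel p
  let u' : E := toCoord I p p u
  let v' : E := toCoord I p p v
  let w' : E := toCoord I p p w
  ofCoord I p p
    (fderiv ℝ (fun z ↦ Γ z v' w') y u' - fderiv ℝ (fun z ↦ Γ z u' w') y v'
      + Γ y u' (Γ y v' w') - Γ y v' (Γ y u' w'))

end PseudoRiemannianMetric

/-- The velocity `x⁽¹⁾(t)` of a curve `x` defined on `S ⊆ ℝ` (one-sided at endpoints). -/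
def curveVelocity (I : ModelWithCorners ℝ E H) (S : Set ℝ) (x : ℝ → M) (t : ℝ) :
    TangentSpace I (x t) :=
  mfderivWithin 𝓘(ℝ, ℝ) I x S t (1 : ℝ)

/-- The Levi-Civita covariant derivative `∇_t W` of a vector field `W` along the curve `x` defined
on `S ⊆ ℝ`. At time `t` it is computed in the chart at `x t`, where its coordinates are
`dW/dt + Γ(x⁽¹⁾, W)`. -/
def PseudoRiemannianMetric.covDerivAlong (g : PseudoRiemannianMetric I M) (S : Set ℝ) (x : ℝ → M)
    (W : ∀ t, TangentSpace I (x t)) (t : ℝ) : TangentSpace I (x t) :=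
  ofCoord I (x t) (x t)
    (derivWithin (fun s ↦ toCoord I (x t) (x s) (W s)) S t
      + g.christoffel (x t) (extChartAt I (x t) (x t))
          (toCoord I (x t) (x t) (curveVelocity I S x t)) (toCoord I (x t) (x t) (W t)))

/-- `x : [t₀, t₁] → M` is a Riemannian cubic: it is smooth and satisfies the Euler-Lagrange equation
`∇_t³ x⁽¹⁾ + R(∇_t x⁽¹⁾, x⁽¹⁾) x⁽¹⁾ = 0` on `[t₀, t₁]`. Only the values of `x` on `[t₀, t₁]`
matter. -/
def PseudoRiemannianMetric.IsRiemannianCubic (g : PseudoRiemannianMetric I M) (t₀ t₁ : ℝ)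
    (x : ℝ → M) : Prop :=
  ContMDiffOn 𝓘(ℝ, ℝ) I ∞ x (Icc t₀ t₁) ∧
  ∀ t ∈ Icc t₀ t₁,
    let D : (∀ t, TangentSpace I (x t)) → ∀ t, TangentSpace I (x t) :=
      g.covDerivAlong (Icc t₀ t₁) x
    let V : ∀ t, TangentSpace I (x t) := curveVelocity I (Icc t₀ t₁) x
    D (D (D V)) t + g.curvature (x t) (D V t) (V t) (V t) = 0

end Manifold

section LieGroup

variable {E : Type*} [NormedAddCommGroup E] [NormedSpace ℝ E]
  {H : Type*} [TopologicalSpace H] {I : ModelWithCorners ℝ E H}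
  {G : Type*} [TopologicalSpace G] [ChartedSpace H G] [Group G]

/-- A pseudo-Riemannian metric on a Lie group is bi-invariant when all left translations and all
right translations are isometries. -/
structure PseudoRiemannianMetric.IsBiInvariant [LieGroup I ∞ G]
    (g : PseudoRiemannianMetric I G) : Prop where
  left : ∀ (a b : G) (u v : TangentSpace I b),
    g.val (a * b) (mfderiv I I (fun c ↦ a * c) b u) (mfderiv I I (fun c ↦ a * c) b v)
      = g.val b u v
  right : ∀ (a b : G) (u v : TangentSpace I b),
    g.val (b * a) (mfderiv I I (fun c ↦ c * a) b u) (mfderiv I I (fun c ↦ c * a) b v)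
      = g.val b u v

/-- `y : ℝ → G` is a `1`-parameter subgroup (a smooth homomorphism) with infinitesimal generator
`A`, that is, with velocity `A` at time `0`. As `y 0 = 1` is not a definitional equality, the
last condition is stated in the tangent bundle. -/
structure IsOneParameterSubgroup (y : ℝ → G) (A : GroupLieAlgebra I G) : Prop where
  contMDiff : ContMDiff 𝓘(ℝ, ℝ) I ∞ y
  map_add : ∀ s t : ℝ, y (s + t) = y s * y t
  generator : (⟨y 0, mfderiv 𝓘(ℝ, ℝ) I y 0 (1 : ℝ)⟩ : TangentBundle I G) = ⟨1, A⟩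

end LieGroup

end

/-!
Every tangent vector of `G` is moved to the Lie algebra by the Maurer-Cartan form
`Θ_q = d(h ↦ q⁻¹ * h)_q` (`maurerCartan`), which takes values in the model space `E = T₁G`. In a
chart it becomes an operator-valued function `θ` (`coframe`), and the fact that left invariant
fields are closed under the Lie bracket becomes the structure equation
`Dθ(u) v - Dθ(v) u = -[θ u, θ v]` (`fderiv_coframe`). Pulled back along a map `f` into `G`, it gives
the same equation for `f^*Θ` (`maurerCartanPullback_structure`); this is the only way in which the
bracket and the group multiplication interact below, and it replaces the adjoint representation.

A left invariant metric is `⟨θ u, θ v⟩` in a chart, for a fixed inner product on the Lie algebra.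
Applying the structure equation to `(a, b) ↦ a * b`, right invariance makes `ad` skew
(`lieForm_skew`). The Koszul formula then gives `Γ(u, v) = θ⁻¹ (Dθ(u) v + ½ [θ u, θ v])`, whence
`Θ (R(u, v) w) = -¼ [[Θ u, Θ v], Θ w]` and `Θ (∇_t W) = w' + ½ [v, w]`, where `w = Θ W` and
`v = Θ x⁽¹⁾`. Substituting, the equation of Riemannian cubics becomes
`v''' + [v, v''] = 0` (`isRiemannianCubic_iff`).

For `x = y z`, one has `v = a + B` where `a(0) = A` and `a' = [a, B]`, by the structure equation
for `(s, t) ↦ y s * z t` (`exists_maurerCartanPullback_mul`). Hence `v''' + [v, v'']` equals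
`k = [a, [[a, B], B]]`. Since `k' = [k, B]`, the function `k` vanishes on `[t₀, t₁]` if and only if
it vanishes at `0`, and `k(0) = [A, [[A, B], B]] = [[[B, A], A], B]` by the Jacobi identity.
-/

/-! ### Connection and curvature of a metric given by a coframe -/

section Calculus

variable {E F : Type*} [NormedAddCommGroup E] [NormedSpace ℝ E]
  [NormedAddCommGroup F] [NormedSpace ℝ F]

/-- Koszul's formula for a metric `Q (θ u) (θ v)`, where the `F`-valued coframe `θ` satisfies the
Maurer-Cartan equation for a bracket `c` and `Q` is nondegenerate and invariant under `c`. The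
left-hand side is the expression that defines `PseudoRiemannianMetric.christoffel`. -/
theorem christoffel_of_coframe [FiniteDimensional ℝ E]
    {T : E → E →L[ℝ] E →L[ℝ] ℝ} {θ : E → E →L[ℝ] F} {Q : F →L[ℝ] F →L[ℝ] ℝ}
    {c : F →L[ℝ] F →L[ℝ] F} {y : E}
    (hT : T =ᶠ[nhds y] fun z ↦ Q.bilinearComp (θ z) (θ z))
    (hθ : DifferentiableAt ℝ θ y) (hinv : (θ y).IsInvertible)
    (hmc : ∀ u v, fderiv ℝ θ y u v - fderiv ℝ θ y v u = -c (θ y u) (θ y v))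
    (hsymm : ∀ a b, Q a b = Q b a) (hnd : ∀ a, (∀ b, Q a b = 0) → a = 0)
    (hskew : ∀ a b d, Q (c a b) d + Q b (c a d) = 0) (hc : ∀ a b, c a b = -c b a) (u v : E) :
    (T y).inverse ((1 / 2 : ℝ) • (fderiv ℝ T y u v + fderiv ℝ T y v u
      - ((fderiv ℝ T y).flip u).flip v))
      = (θ y).inverse (fderiv ℝ θ y u v + (1 / 2 : ℝ) • c (θ y u) (θ y v)) := by
  obtain ⟨e, he⟩ := hinv
  have hTy : ∀ a b, T y a b = Q (θ y a) (θ y b) := fun a b ↦ by rw [hT.eq_of_nhds]; rfl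
  have hTd : DifferentiableAt ℝ T y := by
    refine DifferentiableAt.congr_of_eventuallyEq ?_ hT
    have : (fun z ↦ Q.bilinearComp (θ z) (θ z)) = fun z ↦
        (ContinuousLinearMap.compL ℝ E F ℝ).flip (θ z) ∘L (Q ∘L θ z) := by
      ext z a b; simp
    rw [this]
    fun_prop
  -- The product rule, as `T z a b = Q (θ z a) (θ z b)` near `y`.
  have hD : ∀ w a b, fderiv ℝ T y w a b =
      Q (fderiv ℝ θ y w a) (θ y b) + Q (θ y a) (fderiv ℝ θ y w b) := by
    intro w a b
    have h1 : HasFDerivAt (fun z ↦ T z a b) _ y :=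
      (hTd.hasFDerivAt.clm_apply (hasFDerivAt_const a y)).clm_apply (hasFDerivAt_const b y)
    have ha : HasFDerivAt (fun z ↦ θ z a) _ y := hθ.hasFDerivAt.clm_apply (hasFDerivAt_const a y)
    have hb : HasFDerivAt (fun z ↦ θ z b) _ y := hθ.hasFDerivAt.clm_apply (hasFDerivAt_const b y)
    have h2 : HasFDerivAt (fun z ↦ Q (θ z a) (θ z b)) _ y :=
      ((Q.hasFDerivAt).comp y ha).clm_apply hb
    have h3 : (fun z ↦ T z a b) =ᶠ[nhds y] fun z ↦ Q (θ z a) (θ z b) := by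
      filter_upwards [hT] with z hz
      rw [hz]; rfl
    have h4 := congrArg (fun L ↦ L w) (h1.unique (h2.congr_of_eventuallyEq h3))
    simp at h4
    rw [h4]; ring
  have hinj : Function.Injective (T y) := by
    refine (injective_iff_map_eq_zero _).2 fun a ha ↦ ?_
    have : θ y a = 0 := hnd _ fun b ↦ by
      have := hTy a (e.symm b)
      rw [ha] at this
      rw [show b = θ y (e.symm b) by rw [← he]; simp]
      simpa using this.symm
    rw [← he] at this
    simpa using this
  have hTinv : (T y).IsInvertible := by
    have hrank : Module.finrank ℝ E = Module.finrank ℝ (E →L[ℝ] ℝ) := by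
      rw [← LinearMap.toContinuousLinearMap.finrank_eq]
      exact (Subspace.dual_finrank_eq (K := ℝ) (V := E)).symm
    let L := LinearEquiv.ofInjectiveOfFinrankEq (T y : E →ₗ[ℝ] E →L[ℝ] ℝ) hinj hrank
    exact ⟨L.toContinuousLinearEquiv, by ext a b; rfl⟩
  rw [hTinv.inverse_apply_eq]
  have hθi : ∀ a, θ y ((θ y).inverse a) = a := fun a ↦ by rw [← he]; simp
  ext w
  have hmc' : ∀ a b, fderiv ℝ θ y a b = fderiv ℝ θ y b a - c (θ y a) (θ y b) := fun a b ↦ by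
    rw [sub_eq_add_neg, ← hmc a b]; abel
  simp only [smul_apply, add_apply,
    sub_apply, ContinuousLinearMap.flip_apply, hD, hTy, hθi, map_add, map_smul,
    smul_eq_mul]
  -- The Maurer-Cartan equation turns all derivatives of `θ` into derivatives along `u` and `v`; the
  -- brackets left over cancel by invariance of `Q`.
  rw [hmc' v u, hmc' w u, hmc' w v]
  simp only [map_sub, sub_apply]
  have s1 := hskew (θ y w) (θ y u) (θ y v)
  have s2 := hskew (θ y u) (θ y v) (θ y w)
  have s3 := hskew (θ y v) (θ y u) (θ y w)
  rw [hc (θ y v) (θ y u)] at *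
  rw [hc (θ y w) (θ y v), hc (θ y w) (θ y u)] at *
  simp only [map_neg, neg_apply] at *
  have e1 := hsymm (θ y u) (fderiv ℝ θ y v w)
  have e2 := hsymm (θ y v) (fderiv ℝ θ y u w)
  have e3 := hsymm (θ y v) (c (θ y u) (θ y w))
  have e4 := hsymm (θ y u) (c (θ y v) (θ y w))
  linarith

/-- Curvature of the connection `Γ(u, v) = θ⁻¹ (Dθ(u) v + ½ [θ u, θ v])`. The second derivatives
of `θ` cancel by symmetry, and the Maurer-Cartan equation and the Jacobi identity reduce the rest to
`-¼ [[θ u, θ v], θ w]`. -/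
theorem curvature_of_coframe
    {Γ : E → E → E → E} {θ : E → E →L[ℝ] F} {c : F →L[ℝ] F →L[ℝ] F} {y : E}
    (hΓ : ∀ᶠ z in nhds y, ∀ u v,
      Γ z u v = (θ z).inverse (fderiv ℝ θ z u v + (1 / 2 : ℝ) • c (θ z u) (θ z v)))
    (hθ : ContDiffAt ℝ 2 θ y) (hinv : (θ y).IsInvertible) [CompleteSpace E]
    (hmc : ∀ u v, fderiv ℝ θ y u v - fderiv ℝ θ y v u = -c (θ y u) (θ y v))
    (hjac : ∀ a b d, c a (c b d) = c (c a b) d + c b (c a d))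
    (u v w : E) :
    θ y (fderiv ℝ (fun z ↦ Γ z v w) y u - fderiv ℝ (fun z ↦ Γ z u w) y v
      + Γ y u (Γ y v w) - Γ y v (Γ y u w)) =
    -(1 / 4 : ℝ) • c (c (θ y u) (θ y v)) (θ y w) := by
  have hθ1 : DifferentiableAt ℝ θ y := hθ.differentiableAt (by norm_num)
  have hθ2 : DifferentiableAt ℝ (fderiv ℝ θ) y :=
    (hθ.fderiv_right (m := 1) (by norm_num)).differentiableAt (by norm_num)
  have hsymm : ∀ a b, fderiv ℝ (fderiv ℝ θ) y a b = fderiv ℝ (fderiv ℝ θ) y b a :=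
    fun a b ↦ (hθ.isSymmSndFDerivAt (by simp)).eq a b
  obtain ⟨e, he⟩ := hinv
  have hθi : ∀ a, θ y ((θ y).inverse a) = a := fun a ↦ by rw [← he]; simp
  have hΓy : ∀ a b, θ y (Γ y a b) = fderiv ℝ θ y a b + (1 / 2 : ℝ) • c (θ y a) (θ y b) :=
    fun a b ↦ by rw [hΓ.self_of_nhds, hθi]
  have hinvd : DifferentiableAt ℝ (fun z ↦ (θ z).inverse) y := by
    have h : DifferentiableAt ℝ (ContinuousLinearMap.inverse : (E →L[ℝ] F) → F →L[ℝ] E) (θ y) := by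
      rw [← he]
      exact (contDiffAt_map_inverse (n := 1) e).differentiableAt (by norm_num)
    exact h.comp y hθ1
  have hev : ∀ᶠ z in nhds y, (θ z).IsInvertible := by
    have := hθ1.continuousAt.preimage_mem_nhds (t := range ((↑) : (E ≃L[ℝ] F) → E →L[ℝ] F))
      (by rw [← he]; exact e.nhds)
    exact this
  -- Differentiate `θ (Γ(b, d)) = Dθ(b) d + ½ [θ b, θ d]`.
  have key : ∀ a b d : E, θ y (fderiv ℝ (fun z ↦ Γ z b d) y a) =
      fderiv ℝ (fderiv ℝ θ) y a b d + (1 / 2 : ℝ) • (c (fderiv ℝ θ y a b) (θ y d)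
        + c (θ y b) (fderiv ℝ θ y a d)) - fderiv ℝ θ y a (Γ y b d) := by
    intro a b d
    have hr : HasFDerivAt (fun z ↦ fderiv ℝ θ z b d + (1 / 2 : ℝ) • c (θ z b) (θ z d)) _ y :=
      ((hθ2.hasFDerivAt.clm_apply (hasFDerivAt_const b y)).clm_apply (hasFDerivAt_const d y)).add
      (((c.hasFDerivAt.comp y (hθ1.hasFDerivAt.clm_apply (hasFDerivAt_const b y))).clm_apply
        (hθ1.hasFDerivAt.clm_apply (hasFDerivAt_const d y))).const_smul (1 / 2 : ℝ))
    have hΓd : DifferentiableAt ℝ (fun z ↦ Γ z b d) y := by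
      refine (hinvd.clm_apply hr.differentiableAt).congr_of_eventuallyEq ?_
      filter_upwards [hΓ] with z hz
      exact hz b d
    have hl : HasFDerivAt (fun z ↦ θ z (Γ z b d)) _ y :=
      hθ1.hasFDerivAt.clm_apply hΓd.hasFDerivAt
    have heq : (fun z ↦ θ z (Γ z b d)) =ᶠ[nhds y]
        fun z ↦ fderiv ℝ θ z b d + (1 / 2 : ℝ) • c (θ z b) (θ z d) := by
      filter_upwards [hΓ, hev] with z hz ⟨e', he'⟩
      rw [hz, ← he']; simp
    have h := congrArg (fun L ↦ L a) (hl.unique (hr.congr_of_eventuallyEq heq))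
    simp at h
    rw [eq_sub_iff_add_eq, h]
    module
  have hmc' : fderiv ℝ θ y u v = fderiv ℝ θ y v u - c (θ y u) (θ y v) := by
    rw [sub_eq_add_neg, ← hmc u v]; abel
  simp only [map_add, map_sub, map_smul, key, hΓy, hsymm u v, hmc', sub_apply,
    hjac (θ y u) (θ y v) (θ y w)]
  module

end Calculus

/-! ### The Maurer-Cartan form and the Lie bracket -/

section MaurerCartan

variable {E : Type*} [NormedAddCommGroup E] [NormedSpace ℝ E]
  {H : Type*} [TopologicalSpace H] {I : ModelWithCorners ℝ E H}
  {G : Type*} [TopologicalSpace G] [ChartedSpace H G] [Group G]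

variable (I) in
/-- The left Maurer-Cartan form: the derivative at `q` of left translation by `q⁻¹`. Its values lie
in the Lie algebra `T₁G`, written as the model space `E` (to which `T₁G` is definitionally equal) so
that they carry a norm. -/
noncomputable def maurerCartan (q : G) : TangentSpace I q →L[ℝ] E :=
  (mfderiv I I (fun h ↦ q⁻¹ * h) q : TangentSpace I q →L[ℝ] TangentSpace I (q⁻¹ * q))

/-- The derivative at `1` of left translation by `q`, inverse to the Maurer-Cartan form at `q`; its
value at a vector `a` is that of the left invariant vector field determined by `a`. -/
noncomputable def leftTranslate (I : ModelWithCorners ℝ E H) (q : G) : E →L[ℝ] TangentSpace I q :=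
  (mfderiv I I (fun h ↦ q * h) (1 : G) : TangentSpace I (1 : G) →L[ℝ] TangentSpace I (q * 1))

theorem mulInvariantVectorField_eq (a : GroupLieAlgebra I G) (q : G) :
    mulInvariantVectorField a q = leftTranslate I q a := rfl

theorem maurerCartan_one (u : TangentSpace I (1 : G)) : maurerCartan I (1 : G) u = u := by
  have key : ∀ f : G → G, f = id → ∀ v : E, (mfderiv I I f 1 : E →L[ℝ] E) v = v := by
    rintro _ rfl v
    rw [mfderiv_id]
    rfl
  exact key _ (by ext; simp) u

variable [LieGroup I ∞ G]

instance LieGroup.minSmoothness_three : LieGroup I (minSmoothness ℝ 3) G :=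
  LieGroup.of_le (n := ∞) (by
    rw [minSmoothness_of_isRCLikeNormedField]; exact ENat.LEInfty.out)

instance LieGroup.isManifold_minSmoothness_two : IsManifold I (minSmoothness ℝ 2) G :=
  IsManifold.of_le (n := ∞) (by
    rw [minSmoothness_of_isRCLikeNormedField]; exact ENat.LEInfty.out)

theorem mdifferentiable_const_mul (a : G) : MDifferentiable I I (fun h : G ↦ a * h) :=
  (contMDiff_mul_left (I := I) (n := ∞)).mdifferentiable (by simp)

theorem mdifferentiable_mul_const (a : G) : MDifferentiable I I (fun h : G ↦ h * a) :=
  (contMDiff_mul_right (I := I) (n := ∞)).mdifferentiable (by simp)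

theorem maurerCartan_comp_leftTranslate (q : G) :
    maurerCartan I q ∘L leftTranslate I q = ContinuousLinearMap.id ℝ E := by
  have h : mfderiv I I ((fun h : G ↦ q⁻¹ * h) ∘ (fun h ↦ q * h)) (1 : G) =
      ContinuousLinearMap.id _ _ := by
    have : (fun h : G ↦ q⁻¹ * h) ∘ (fun h ↦ q * h) = id := by ext; simp
    rw [this, id_eq, mfderiv_id]
  rw [mfderiv_comp (I' := I) _ (mdifferentiable_const_mul _ _) (mdifferentiable_const_mul _ _)] at h
  have e : (mfderiv I I (fun h ↦ q⁻¹ * h) q : E →L[ℝ] E) =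
    (mfderiv I I (fun h ↦ q⁻¹ * h) (q * 1) : E →L[ℝ] E) := by rw [mul_one]
  exact (congrArg (fun L : E →L[ℝ] E ↦ L ∘L (leftTranslate I q : E →L[ℝ] E)) e).trans h

theorem leftTranslate_comp_maurerCartan (q : G) :
    leftTranslate I q ∘L maurerCartan I q = ContinuousLinearMap.id ℝ (TangentSpace I q) := by
  have h : mfderiv I I ((fun h : G ↦ q * h) ∘ (fun h ↦ q⁻¹ * h)) q =
      ContinuousLinearMap.id _ _ := by
    have : (fun h : G ↦ q * h) ∘ (fun h ↦ q⁻¹ * h) = id := by ext; simp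
    rw [this, id_eq, mfderiv_id]
  rw [mfderiv_comp (I' := I) _ (mdifferentiable_const_mul _ _) (mdifferentiable_const_mul _ _)] at h
  have e : (mfderiv I I (fun h ↦ q * h) 1 : E →L[ℝ] E) =
    (mfderiv I I (fun h ↦ q * h) (q⁻¹ * q) : E →L[ℝ] E) := by rw [inv_mul_cancel]
  exact (congrArg (fun L : E →L[ℝ] E ↦ L ∘L (maurerCartan I q : E →L[ℝ] E)) e).trans h

theorem maurerCartan_leftTranslate (q : G) (a : E) :
    maurerCartan I q (leftTranslate I q a) = a :=
  congrArg (fun L ↦ L a) (maurerCartan_comp_leftTranslate q)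

theorem leftTranslate_maurerCartan (q : G) (u : TangentSpace I q) :
    leftTranslate I q (maurerCartan I q u) = u :=
  congrArg (fun L ↦ L u) (leftTranslate_comp_maurerCartan q)

theorem maurerCartan_injective (q : G) : Function.Injective (maurerCartan I q) :=
  Function.LeftInverse.injective (leftTranslate_maurerCartan q)

section Bracket

variable [FiniteDimensional ℝ E]

variable (I G) in
/-- The Lie bracket of `T₁G` as a continuous bilinear map on the model space. -/
noncomputable def lieBracketCLM : E →L[ℝ] E →L[ℝ] E :=
  haveI : CompleteSpace E := FiniteDimensional.complete ℝ E
  let B : E →ₗ[ℝ] E →ₗ[ℝ] E :=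
    LinearMap.mk₂ ℝ (M := GroupLieAlgebra I G) (Nₗ := GroupLieAlgebra I G)
      (Pₗ := GroupLieAlgebra I G) (fun a b ↦ ⁅a, b⁆) add_lie smul_lie lie_add
      (fun c a b ↦ lie_smul c a b)
  LinearMap.toContinuousLinearMap
    ((LinearMap.toContinuousLinearMap (𝕜 := ℝ) (E := E) (F' := E) : _ →ₗ[ℝ] _) ∘ₗ B)

theorem lieBracketCLM_apply (a b : GroupLieAlgebra I G) : lieBracketCLM I G a b = ⁅a, b⁆ := rfl

theorem lieBracketCLM_skew (a b : E) : lieBracketCLM I G a b = - lieBracketCLM I G b a := by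
  have : CompleteSpace E := FiniteDimensional.complete ℝ E
  exact (lie_skew (L := GroupLieAlgebra I G) a b).symm

theorem lieBracketCLM_self (a : E) : lieBracketCLM I G a a = 0 := by
  have : CompleteSpace E := FiniteDimensional.complete ℝ E
  exact lie_self (L := GroupLieAlgebra I G) a

theorem lieBracketCLM_jacobi (a b d : E) :
    lieBracketCLM I G a (lieBracketCLM I G b d) =
      lieBracketCLM I G (lieBracketCLM I G a b) d + lieBracketCLM I G b (lieBracketCLM I G a d) := by
  have : CompleteSpace E := FiniteDimensional.complete ℝ E
  exact leibniz_lie (L₁ := GroupLieAlgebra I G) (L₂ := GroupLieAlgebra I G)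
    (M := GroupLieAlgebra I G) a b d

end Bracket

variable (I) in
/-- The Maurer-Cartan form in the chart at `p`, at the coordinate point `y`. It is meaningful for
`y` in the target of the chart. -/
noncomputable def coframe (p : G) (y : E) : E →L[ℝ] E :=
  maurerCartan I ((extChartAt I p).symm y) ∘L ofCoord I p ((extChartAt I p).symm y)

variable [I.Boundaryless]

theorem ofCoord_eq_mfderiv {p : G} {y : E} (hy : y ∈ (extChartAt I p).target) :
    ofCoord I p ((extChartAt I p).symm y) = mfderiv 𝓘(ℝ, E) I (extChartAt I p).symm y := by
  have hs : (extChartAt I p).symm y ∈ (chartAt H p).source := by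
    simpa using (extChartAt I p).map_target hy
  unfold ofCoord
  rw [TangentBundle.symmL_trivializationAt hs, I.range_eq_univ, mfderivWithin_univ,
    (extChartAt I p).right_inv hy]

theorem isInvertible_mfderiv_symm {p : G} {y : E} (hy : y ∈ (extChartAt I p).target) :
    (mfderiv 𝓘(ℝ, E) I (extChartAt I p).symm y).IsInvertible := by
  have := isInvertible_mfderivWithin_extChartAt_symm hy
  rwa [I.range_eq_univ, mfderivWithin_univ] at this

theorem isInvertible_coframe {p : G} {y : E} (hy : y ∈ (extChartAt I p).target) :
    (coframe I p y).IsInvertible := by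
  unfold coframe
  rw [ofCoord_eq_mfderiv hy]
  refine ContinuousLinearMap.IsInvertible.comp ?_ (isInvertible_mfderiv_symm hy)
  exact ⟨ContinuousLinearEquiv.equivOfInverse' _ _ (maurerCartan_comp_leftTranslate _)
    (leftTranslate_comp_maurerCartan _), rfl⟩

/-- In a chart, the left invariant vector fields are the fields `y ↦ (θ y)⁻¹ a`. -/
theorem coframe_inverse_apply {p : G} {y : E} (hy : y ∈ (extChartAt I p).target)
    (a : GroupLieAlgebra I G) : (coframe I p y).inverse a =
      VectorField.mpullback 𝓘(ℝ, E) I (extChartAt I p).symm (mulInvariantVectorField a) y := by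
  refine (isInvertible_coframe hy).inverse_apply_eq.2 ?_
  unfold coframe
  rw [ofCoord_eq_mfderiv hy, VectorField.mpullback_apply, mulInvariantVectorField_eq]
  have := (isInvertible_mfderiv_symm hy).self_apply_inverse
    (leftTranslate I ((extChartAt I p).symm y) a)
  exact ((congrArg (maurerCartan I _) this).trans (maurerCartan_leftTranslate _ _)).symm

theorem contMDiffAt_extChartAt_symm {p : G} {y : E} (hy : y ∈ (extChartAt I p).target) :
    ContMDiffAt 𝓘(ℝ, E) I ∞ (extChartAt I p).symm y :=
  (contMDiffOn_extChartAt_symm p).contMDiffAt ((isOpen_extChartAt_target p).mem_nhds hy)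

/-- The inverse of the coframe is smooth because its columns are left invariant vector fields; the
coframe itself is then smooth because inversion of operators is. -/
theorem contDiffAt_coframe [FiniteDimensional ℝ E] {p : G} {y : E}
    (hy : y ∈ (extChartAt I p).target) : ContDiffAt ℝ 2 (coframe I p) y := by
  have : CompleteSpace E := FiniteDimensional.complete ℝ E
  have h : ContDiffOn ℝ 2 (fun z ↦ (coframe I p z).inverse) (extChartAt I p).target := by
    refine contDiffOn_clm_apply.2 fun a z hz ↦ ContDiffAt.contDiffWithinAt ?_
    have h1 : ContDiffAt ℝ 2 (VectorField.mpullback 𝓘(ℝ, E) I (extChartAt I p).symm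
        (mulInvariantVectorField (a : GroupLieAlgebra I G))) z := by
      rw [← contMDiffAt_vectorSpace_iff_contDiffAt]
      refine ContMDiffAt.mpullback_vectorField_preimage (n := ∞) ?_ (contMDiffAt_extChartAt_symm hz)
        (isInvertible_mfderiv_symm hz)
        (by rw [show (2 : ℕ∞ω) + 1 = 3 by norm_num]; exact ENat.LEInfty.out)
      exact (contMDiffAt_mulInvariantVectorField (I := I) a
        (g := (extChartAt I p).symm z)).of_le le_minSmoothness
    refine h1.congr_of_eventuallyEq ?_
    filter_upwards [(isOpen_extChartAt_target p).mem_nhds hz] with w hw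
    exact coframe_inverse_apply hw a
  have h2 := h.contDiffAt ((isOpen_extChartAt_target p).mem_nhds hy)
  obtain ⟨e, he⟩ := isInvertible_coframe hy
  have h3 : ContDiffAt ℝ 2 (ContinuousLinearMap.inverse : (E →L[ℝ] E) → E →L[ℝ] E)
      (coframe I p y).inverse := by
    rw [← he, ContinuousLinearMap.inverse_equiv]
    exact contDiffAt_map_inverse e.symm
  refine (h3.comp y h2).congr_of_eventuallyEq ?_
  filter_upwards [(isOpen_extChartAt_target p).mem_nhds hy] with w hw
  obtain ⟨e', he'⟩ := isInvertible_coframe hw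
  simp [← he']

variable [FiniteDimensional ℝ E]

/-- The Maurer-Cartan structure equation in a chart. It dualizes the fact that the bracket of the
left invariant fields of `a` and `b` is the left invariant field of `⁅a, b⁆`. -/
theorem fderiv_coframe {p : G} {y : E} (hy : y ∈ (extChartAt I p).target) (u v : E) :
    fderiv ℝ (coframe I p) y u v - fderiv ℝ (coframe I p) y v u =
      -lieBracketCLM I G (coframe I p y u) (coframe I p y v) := by
  have : CompleteSpace E := FiniteDimensional.complete ℝ E
  have hθ : DifferentiableAt ℝ (coframe I p) y :=
    (contDiffAt_coframe hy).differentiableAt (by norm_num)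
  obtain ⟨e, he⟩ := isInvertible_coframe hy
  have hθi : ∀ a, (coframe I p y).inverse (coframe I p y a) = a := fun a ↦ by rw [← he]; simp
  let X : E → E → E := fun a z ↦ (coframe I p z).inverse a
  have hX : ∀ a : GroupLieAlgebra I G, X a =ᶠ[nhds y]
      VectorField.mpullback 𝓘(ℝ, E) I (extChartAt I p).symm (mulInvariantVectorField a) := fun a ↦ by
    filter_upwards [(isOpen_extChartAt_target p).mem_nhds hy] with z hz
    exact coframe_inverse_apply hz a
  have hXd : ∀ a, DifferentiableAt ℝ (X a) y := fun a ↦ by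
    have : DifferentiableAt ℝ (ContinuousLinearMap.inverse : (E →L[ℝ] E) → E →L[ℝ] E)
        (coframe I p y) := by
      rw [← he]
      exact (contDiffAt_map_inverse (n := 1) e).differentiableAt (by norm_num)
    exact (this.comp y hθ).clm_apply (differentiableAt_const a)
  -- Differentiate `θ (X a) = a`.
  have hDX : ∀ a w, coframe I p y (fderiv ℝ (X a) y w) = - fderiv ℝ (coframe I p) y w (X a y) := by
    intro a w
    have h1 := hθ.hasFDerivAt.clm_apply (hXd a).hasFDerivAt
    have h2 : (fun z ↦ coframe I p z (X a z)) =ᶠ[nhds y] fun _ ↦ a := by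
      filter_upwards [(isOpen_extChartAt_target p).mem_nhds hy] with z hz
      exact (isInvertible_coframe hz).self_apply_inverse a
    have h := congrArg (fun L ↦ L w) (h1.unique ((hasFDerivAt_const a y).congr_of_eventuallyEq h2))
    exact eq_neg_of_add_eq_zero_left (by simpa using h)
  have key : ∀ a b : GroupLieAlgebra I G,
      coframe I p y (VectorField.lieBracket ℝ (X a) (X b) y) = lieBracketCLM I G a b := by
    intro a b
    have h1 := VectorField.mpullback_mlieBracket (I := 𝓘(ℝ, E)) (I' := I) (n := ∞) (x₀ := y)
      (f := (extChartAt I p).symm)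
      (mdifferentiableAt_mulInvariantVectorField a) (mdifferentiableAt_mulInvariantVectorField b)
      (contMDiffAt_extChartAt_symm hy)
      (by rw [minSmoothness_of_isRCLikeNormedField]; exact ENat.LEInfty.out)
    rw [← mulInvariantVector_mlieBracket, ← GroupLieAlgebra.bracket_def,
      ← coframe_inverse_apply hy, ← lieBracketCLM_apply, ← VectorField.mlieBracketWithin_univ,
      VectorField.mlieBracketWithin_eq_lieBracketWithin] at h1
    have h2 := (VectorField.lieBracketWithin_univ (𝕜 := ℝ) (V := VectorField.mpullback 𝓘(ℝ, E) I
      (extChartAt I p).symm (mulInvariantVectorField a)) (W := VectorField.mpullback 𝓘(ℝ, E) I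
      (extChartAt I p).symm (mulInvariantVectorField b)))
    have h3 := h1.trans (congrFun h2 y)
    rw [Filter.EventuallyEq.lieBracket_vectorField_eq (hX a) (hX b)]
    exact (congrArg (coframe I p y) h3).symm.trans
      ((isInvertible_coframe hy).self_apply_inverse _)
  have h := key (coframe I p y u) (coframe I p y v)
  rw [VectorField.lieBracket, map_sub, hDX, hDX] at h
  simp only [X, hθi] at h
  rw [← h]; abel

end MaurerCartan

/-! ### Pullback of the Maurer-Cartan form -/

section Pullback

variable {E : Type*} [NormedAddCommGroup E] [NormedSpace ℝ E]
  {H : Type*} [TopologicalSpace H] {I : ModelWithCorners ℝ E H}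
  {G : Type*} [TopologicalSpace G] [ChartedSpace H G] [Group G]
  {P P' : Type*} [NormedAddCommGroup P] [NormedSpace ℝ P]
  [NormedAddCommGroup P'] [NormedSpace ℝ P']

variable (I) in
/-- The pullback `f^*Θ` of the Maurer-Cartan form along a map `f` from a normed space to `G`. -/
noncomputable def maurerCartanPullback (f : P → G) (r : P) : P →L[ℝ] E :=
  maurerCartan I (f r) ∘L (mfderiv 𝓘(ℝ, P) I f r : P →L[ℝ] TangentSpace I (f r))

theorem maurerCartanPullback_comp {f : P → G} {h : P' → P} {r : P'}
    (hf : MDifferentiableAt 𝓘(ℝ, P) I f (h r)) (hh : DifferentiableAt ℝ h r) :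
    maurerCartanPullback I (fun s ↦ f (h s)) r =
      maurerCartanPullback I f (h r) ∘L fderiv ℝ h r := by
  have e : mfderiv 𝓘(ℝ, P') I (f ∘ h) r =
      mfderiv 𝓘(ℝ, P) I f (h r) ∘L mfderiv 𝓘(ℝ, P') 𝓘(ℝ, P) h r :=
    mfderiv_comp (I' := 𝓘(ℝ, P)) _ hf hh.mdifferentiableAt
  rw [mfderiv_eq_fderiv] at e
  exact congrArg (fun L : P' →L[ℝ] E ↦ (maurerCartan I (f (h r)) : E →L[ℝ] E) ∘L L) e

variable [LieGroup I ∞ G]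

theorem coframe_extChartAt {p q : G} (hq : q ∈ (chartAt H p).source) :
    coframe I p (extChartAt I p q) = maurerCartan I q ∘L ofCoord I p q := by
  rw [coframe, (extChartAt I p).left_inv (by simpa using hq)]

theorem ofCoord_toCoord {p q : G} (hq : q ∈ (chartAt H p).source) (u : TangentSpace I q) :
    ofCoord I p q (toCoord I p q u) = u :=
  Trivialization.symmL_continuousLinearMapAt _ (by simpa using hq) u

theorem coframe_toCoord {p q : G} (hq : q ∈ (chartAt H p).source) (u : TangentSpace I q) :
    coframe I p (extChartAt I p q) (toCoord I p q u) = maurerCartan I q u := by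
  rw [coframe_extChartAt hq, ContinuousLinearMap.comp_apply, ofCoord_toCoord hq]

theorem maurerCartan_ofCoord_self (p : G) (u : E) :
    maurerCartan I p (ofCoord I p p u) = coframe I p (extChartAt I p p) u := by
  rw [coframe_extChartAt (mem_chart_source H p)]; rfl

theorem maurerCartan_mfderiv_mul_left (a q : G) (u : TangentSpace I q) :
    maurerCartan I (a * q) (mfderiv I I (fun h ↦ a * h) q u) = maurerCartan I q u := by
  have h : mfderiv I I ((fun h : G ↦ (a * q)⁻¹ * h) ∘ (fun h ↦ a * h)) q =
      mfderiv I I (fun h ↦ (a * q)⁻¹ * h) (a * q) ∘L mfderiv I I (fun h ↦ a * h) q :=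
    mfderiv_comp (I' := I) _ (mdifferentiable_const_mul _ _) (mdifferentiable_const_mul _ _)
  have e : ∀ f : G → G, f = (fun h ↦ q⁻¹ * h) → (mfderiv I I f q : E →L[ℝ] E) =
      (mfderiv I I (fun h : G ↦ q⁻¹ * h) q : E →L[ℝ] E) := by
    rintro _ rfl; rfl
  -- `(a * q)⁻¹ * (a * h) = q⁻¹ * h`
  have e' := e ((fun h : G ↦ (a * q)⁻¹ * h) ∘ (fun h ↦ a * h)) (by ext; simp [mul_assoc])
  exact congrArg (fun L : E →L[ℝ] E ↦ L u) (h.symm.trans e')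

/-- The pullback is unchanged when the map is followed by a left translation. -/
theorem maurerCartanPullback_mul_left (a : G) {f : P → G} {r : P}
    (hf : MDifferentiableAt 𝓘(ℝ, P) I f r) :
    maurerCartanPullback I (fun s ↦ a * f s) r = maurerCartanPullback I f r := by
  have h : mfderiv 𝓘(ℝ, P) I ((fun h : G ↦ a * h) ∘ f) r =
      mfderiv I I (fun h ↦ a * h) (f r) ∘L mfderiv 𝓘(ℝ, P) I f r :=
    mfderiv_comp (I' := I) _ (mdifferentiable_const_mul _ _) hf
  ext u
  exact (congrArg (fun L : P →L[ℝ] E ↦ (maurerCartan I (a * f r) : E →L[ℝ] E) (L u)) h).trans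
    (maurerCartan_mfderiv_mul_left a (f r) _)

theorem maurerCartanPullback_eq_coframe {f : P → G} {r : P} (p : G)
    (hf : MDifferentiableAt 𝓘(ℝ, P) I f r) (hr : f r ∈ (chartAt H p).source) :
    maurerCartanPullback I f r =
      coframe I p (extChartAt I p (f r)) ∘L fderiv ℝ (fun s ↦ extChartAt I p (f s)) r := by
  have e : mfderiv 𝓘(ℝ, P) 𝓘(ℝ, E) (extChartAt I p ∘ f) r =
      mfderiv I 𝓘(ℝ, E) (extChartAt I p) (f r) ∘L mfderiv 𝓘(ℝ, P) I f r :=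
    mfderiv_comp (I' := I) _ (mdifferentiableAt_extChartAt hr) hf
  rw [← TangentBundle.continuousLinearMapAt_trivializationAt hr] at e
  rw [mfderiv_eq_fderiv] at e
  ext u
  have e' := congrArg (fun L : P →L[ℝ] E ↦ coframe I p (extChartAt I p (f r)) (L u)) e
  refine Eq.trans ?_ e'.symm
  exact (coframe_toCoord hr _).symm

variable [I.Boundaryless] [FiniteDimensional ℝ E]

/-- The structure equation for the pullback of the Maurer-Cartan form along a `C²` map. -/
theorem maurerCartanPullback_structure {f : P → G} {r : P}
    (hf : ContMDiffAt 𝓘(ℝ, P) I 2 f r) :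
    DifferentiableAt ℝ (maurerCartanPullback I f) r ∧ ∀ u v,
      fderiv ℝ (maurerCartanPullback I f) r u v - fderiv ℝ (maurerCartanPullback I f) r v u =
        -lieBracketCLM I G (maurerCartanPullback I f r u) (maurerCartanPullback I f r v) := by
  have : IsManifold I 2 G := IsManifold.of_le (n := ∞) ENat.LEInfty.out
  set p := f r
  let F : P → E := fun s ↦ extChartAt I p (f s)
  have hsrc : ∀ᶠ s in nhds r, f s ∈ (chartAt H p).source :=
    hf.continuousAt.preimage_mem_nhds (chart_source_mem_nhds H p)
  have hdf : ∀ᶠ s in nhds r, MDifferentiableAt 𝓘(ℝ, P) I f s := by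
    filter_upwards [(contMDiffAt_iff_contMDiffAt_nhds (by simp)).1 hf] with s hs
    exact hs.mdifferentiableAt (by simp)
  have hF : ContDiffAt ℝ 2 F r := by
    rw [← contMDiffAt_iff_contDiffAt]
    exact (contMDiffAt_extChartAt (x := p)).comp r hf
  have hy : F r ∈ (extChartAt I p).target := mem_extChartAt_target p
  have heq : maurerCartanPullback I f =ᶠ[nhds r] fun s ↦ coframe I p (F s) ∘L fderiv ℝ F s := by
    filter_upwards [hsrc, hdf] with s h1 h2
    exact maurerCartanPullback_eq_coframe p h2 h1
  have hθ : DifferentiableAt ℝ (coframe I p) (F r) :=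
    (contDiffAt_coframe hy).differentiableAt (by norm_num)
  have hF1 : DifferentiableAt ℝ F r := hF.differentiableAt (by norm_num)
  have hF2 : DifferentiableAt ℝ (fderiv ℝ F) r :=
    (hF.fderiv_right (m := 1) (by norm_num)).differentiableAt (by norm_num)
  have hd := ((hθ.hasFDerivAt.comp r hF1.hasFDerivAt).clm_comp hF2.hasFDerivAt)
  have hd' := hd.congr_of_eventuallyEq heq
  refine ⟨hd'.differentiableAt, fun u v ↦ ?_⟩
  have hsymm := (hF.isSymmSndFDerivAt (by simp)).eq u v
  have hmc := fderiv_coframe hy (fderiv ℝ F r u) (fderiv ℝ F r v)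
  rw [hd'.fderiv, heq.self_of_nhds]
  simp only [ContinuousLinearMap.comp_apply, ← hmc]
  simp [hsymm]

end Pullback

/-! ### Bi-invariant metrics -/

section BiInvariant

variable {E : Type*} [NormedAddCommGroup E] [NormedSpace ℝ E]
  {H : Type*} [TopologicalSpace H] {I : ModelWithCorners ℝ E H}
  {G : Type*} [TopologicalSpace G] [ChartedSpace H G] [Group G] [LieGroup I ∞ G]

namespace PseudoRiemannianMetric

/-- The bilinear form induced on the Lie algebra, written on the model space. -/
noncomputable def lieForm (g : PseudoRiemannianMetric I G) : E →L[ℝ] E →L[ℝ] ℝ := g.val 1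

variable {g : PseudoRiemannianMetric I G}

theorem IsBiInvariant.val_eq (hg : g.IsBiInvariant) (q : G) (u v : TangentSpace I q) :
    g.val q u v = g.lieForm (maurerCartan I q u) (maurerCartan I q v) := by
  have h := hg.left q⁻¹ q u v
  have e : ∀ q' : G, q' = 1 → (g.val q' : E →L[ℝ] E →L[ℝ] ℝ) = g.lieForm := by
    rintro _ rfl; rfl
  rw [← h]
  exact congrArg (fun L : E →L[ℝ] E →L[ℝ] ℝ ↦ L (maurerCartan I q u) (maurerCartan I q v))
    (e (q⁻¹ * q) (inv_mul_cancel q))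

/-- The metric in a chart is obtained from the form on the Lie algebra and the coframe. Outside the
target of the chart both sides are evaluated at the same junk point, so that no condition on the
coordinate point is needed. -/
theorem IsBiInvariant.inChart_eq (hg : g.IsBiInvariant) (p : G) :
    g.inChart p = fun y ↦ g.lieForm.bilinearComp (coframe I p y) (coframe I p y) := by
  ext y u v
  exact hg.val_eq _ _ _

theorem lieForm_symm (a b : E) : g.lieForm a b = g.lieForm b a := g.symm 1 a b

theorem lieForm_nondegenerate (a : E) (h : ∀ b, g.lieForm a b = 0) : a = 0 :=
  g.nondegenerate 1 a h

variable [I.Boundaryless] [FiniteDimensional ℝ E]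

/-- For a bi-invariant metric, `ad a` is skew. This is the structure equation of the map
`f (y, z) = φ⁻¹ y * φ⁻¹ z`, where `φ` is the chart at `1`: by right invariance, the inner product
of `f^*Θ (u, 0)` and `f^*Θ (u', 0)` is independent of `z`, and by left invariance `f^*Θ (0, v)` is
independent of `y`, so that the derivative of `f^*Θ (u, 0)` with respect to `z` is a bracket. -/
theorem IsBiInvariant.lieForm_skew (hg : g.IsBiInvariant) (a b d : E) :
    g.lieForm (lieBracketCLM I G a b) d + g.lieForm b (lieBracketCLM I G a d) = 0 := by
  set φ := extChartAt I (1 : G)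
  set e : E := φ 1
  have he : e ∈ φ.target := mem_extChartAt_target (1 : G)
  have hφe : φ.symm e = 1 := extChartAt_to_inv (1 : G)
  have hnhds : φ.target ∈ nhds e := (isOpen_extChartAt_target (1 : G)).mem_nhds he
  have hψ : ∀ y ∈ φ.target, MDifferentiableAt 𝓘(ℝ, E) I φ.symm y := fun y hy ↦
    (contMDiffAt_extChartAt_symm hy).mdifferentiableAt (by simp)
  let f : E × E → G := fun r ↦ φ.symm r.1 * φ.symm r.2
  have hf : ∀ y ∈ φ.target, ∀ z ∈ φ.target, ContMDiffAt 𝓘(ℝ, E × E) I 2 f (y, z) := by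
    intro y hy z hz
    have h1 : ContMDiffAt 𝓘(ℝ, E × E) I ∞ (fun r : E × E ↦ φ.symm r.1) (y, z) :=
      ContMDiffAt.comp (I' := 𝓘(ℝ, E)) (y, z) (contMDiffAt_extChartAt_symm hy)
        contDiffAt_fst.contMDiffAt
    have h2 : ContMDiffAt 𝓘(ℝ, E × E) I ∞ (fun r : E × E ↦ φ.symm r.2) (y, z) :=
      ContMDiffAt.comp (I' := 𝓘(ℝ, E)) (y, z) (contMDiffAt_extChartAt_symm hz)
        contDiffAt_snd.contMDiffAt
    exact (h1.mul h2).of_le ENat.LEInfty.out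
  have hfd : ∀ y ∈ φ.target, ∀ z ∈ φ.target, MDifferentiableAt 𝓘(ℝ, E × E) I f (y, z) :=
    fun y hy z hz ↦ (hf y hy z hz).mdifferentiableAt (by simp)
  have hsnd : ∀ y ∈ φ.target, ∀ z ∈ φ.target, ∀ v,
      maurerCartanPullback I f (y, z) (0, v) = maurerCartanPullback I φ.symm z v := by
    intro y hy z hz v
    have h1 := maurerCartanPullback_comp (h := fun z : E ↦ (y, z)) (r := z) (hfd y hy z hz)
      (hasFDerivAt_prodMk_right y z).differentiableAt
    rw [(hasFDerivAt_prodMk_right y z).fderiv,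
      maurerCartanPullback_mul_left (φ.symm y) (hψ z hz)] at h1
    rw [h1]; simp
  have hfst : ∀ y ∈ φ.target, ∀ z ∈ φ.target, ∀ u,
      maurerCartanPullback I f (y, z) (u, 0) =
        maurerCartanPullback I (fun y ↦ φ.symm y * φ.symm z) y u := by
    intro y hy z hz u
    have h1 := maurerCartanPullback_comp (h := fun y : E ↦ (y, z)) (r := y) (hfd y hy z hz)
      (hasFDerivAt_prodMk_left y z).differentiableAt
    rw [(hasFDerivAt_prodMk_left y z).fderiv] at h1
    rw [h1]; simp
  have hconst : ∀ z ∈ φ.target, ∀ u u',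
      g.lieForm (maurerCartanPullback I f (e, z) (u, 0)) (maurerCartanPullback I f (e, z) (u', 0)) =
      g.val (φ.symm e) (mfderiv 𝓘(ℝ, E) I φ.symm e u) (mfderiv 𝓘(ℝ, E) I φ.symm e u') := by
    intro z hz u u'
    rw [hfst e he z hz, hfst e he z hz]
    have h1 : mfderiv 𝓘(ℝ, E) I ((fun h ↦ h * φ.symm z) ∘ φ.symm) e =
        mfderiv I I (fun h ↦ h * φ.symm z) (φ.symm e) ∘L mfderiv 𝓘(ℝ, E) I φ.symm e :=
      mfderiv_comp (I' := I) _ (mdifferentiable_mul_const _ _) (hψ e he)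
    rw [← hg.right (φ.symm z) (φ.symm e), hg.val_eq]
    have h2 := fun w ↦ congrArg (fun L : E →L[ℝ] E ↦ maurerCartan I (φ.symm e * φ.symm z) (L w)) h1
    exact congrArg₂ (fun a b ↦ g.lieForm a b) (h2 u) (h2 u')
  obtain ⟨ε, hε⟩ := isInvertible_coframe he
  have hsurj : ∀ a, ∃ u, maurerCartanPullback I φ.symm e u = a := fun a ↦ by
    refine ⟨ε.symm a, ?_⟩
    have : maurerCartanPullback I φ.symm e = coframe I (1 : G) e := by
      rw [coframe, ofCoord_eq_mfderiv he]; rfl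
    rw [this, ← hε]; simp
  have hfst' : ∀ u, maurerCartanPullback I f (e, e) (u, 0) = maurerCartanPullback I φ.symm e u := by
    intro u
    rw [hfst e he e he, hφe]
    simp only [mul_one]
  obtain ⟨u, hu⟩ := hsurj b
  obtain ⟨u', hu'⟩ := hsurj d
  obtain ⟨v, hv⟩ := hsurj a
  obtain ⟨hd, hmc⟩ := maurerCartanPullback_structure (hf e he e he)
  have hD : ∀ u, fderiv ℝ (maurerCartanPullback I f) (e, e) (0, v) (u, 0) =
      - lieBracketCLM I G a (maurerCartanPullback I φ.symm e u) := by
    intro u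
    have h1 : fderiv ℝ (maurerCartanPullback I f) (e, e) (u, 0) (0, v) = 0 := by
      have h2 : HasFDerivAt (fun y ↦ maurerCartanPullback I f (y, e) (0, v)) _ e :=
        (HasFDerivAt.comp (f := fun y ↦ (y, e)) e hd.hasFDerivAt
          (hasFDerivAt_prodMk_left e e)).clm_apply
          (hasFDerivAt_const ((0 : E), v) e)
      have h3 : (fun y ↦ maurerCartanPullback I f (y, e) (0, v)) =ᶠ[nhds e]
          fun _ ↦ maurerCartanPullback I φ.symm e v := by
        filter_upwards [hnhds] with y hy
        exact hsnd y hy e he v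
      have h4 := congrArg (fun L ↦ L u)
        (h2.unique ((hasFDerivAt_const _ e).congr_of_eventuallyEq h3))
      simpa using h4
    have h2 := hmc (0, v) (u, 0)
    rwa [h1, sub_zero, hfst', hsnd e he e he, hv] at h2
  have hcurve : ∀ u, HasFDerivAt (fun z ↦ maurerCartanPullback I f (e, z) (u, 0)) _ e := fun u ↦
    (hd.hasFDerivAt.comp e (hasFDerivAt_prodMk_right e e)).clm_apply
      (hasFDerivAt_const (u, (0 : E)) e)
  have h1 := (g.lieForm.hasFDerivAt.comp e (hcurve u)).clm_apply (hcurve u')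
  have h2 := congrArg (fun L ↦ L v) (h1.unique ((hasFDerivAt_const _ e).congr_of_eventuallyEq
    (by filter_upwards [hnhds] with z hz; exact hconst z hz u u')))
  simp [hD, hfst', hu, hu'] at h2
  linarith

theorem IsBiInvariant.christoffel_eq (hg : g.IsBiInvariant) {p : G} {y : E}
    (hy : y ∈ (extChartAt I p).target) (u v : E) :
    g.christoffel p y u v = (coframe I p y).inverse (fderiv ℝ (coframe I p) y u v +
      (1 / 2 : ℝ) • lieBracketCLM I G (coframe I p y u) (coframe I p y v)) :=
  christoffel_of_coframe (Filter.EventuallyEq.of_eq (hg.inChart_eq p))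
    ((contDiffAt_coframe hy).differentiableAt (by norm_num)) (isInvertible_coframe hy)
    (fderiv_coframe hy) lieForm_symm lieForm_nondegenerate hg.lieForm_skew lieBracketCLM_skew u v

theorem IsBiInvariant.maurerCartan_curvature (hg : g.IsBiInvariant) (p : G)
    (u v w : TangentSpace I p) :
    maurerCartan I p (g.curvature p u v w) = -(1 / 4 : ℝ) •
      lieBracketCLM I G (lieBracketCLM I G (maurerCartan I p u) (maurerCartan I p v))
        (maurerCartan I p w) := by
  have : CompleteSpace E := FiniteDimensional.complete ℝ E
  have hy := mem_extChartAt_target (I := I) p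
  rw [curvature, maurerCartan_ofCoord_self]
  rw [curvature_of_coframe (Γ := g.christoffel p) (c := lieBracketCLM I G) ?_
    (contDiffAt_coframe hy) (isInvertible_coframe hy) (fderiv_coframe hy) lieBracketCLM_jacobi]
  · simp only [coframe_toCoord (mem_chart_source H p)]
  · filter_upwards [(isOpen_extChartAt_target p).mem_nhds hy] with z hz u v
    exact hg.christoffel_eq hz u v

/-- The covariant derivative along a curve, read in the Lie algebra: the vector field `W` with
`Θ W = w` along `x` satisfies `Θ (∇_t W) = w' + ½ [Θ x⁽¹⁾, w]`. -/
theorem IsBiInvariant.maurerCartan_covDerivAlong (hg : g.IsBiInvariant) {S : Set ℝ} {x : ℝ → G}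
    {W : ∀ t, TangentSpace I (x t)} {w : ℝ → E} {w' : E} {t : ℝ} (ht : t ∈ S)
    (hS : UniqueDiffWithinAt ℝ S t) (hx : MDifferentiableWithinAt 𝓘(ℝ, ℝ) I x S t)
    (hW : ∀ s ∈ S, maurerCartan I (x s) (W s) = w s) (hw : HasDerivWithinAt w w' S t) :
    maurerCartan I (x t) (g.covDerivAlong S x W t) =
      w' + (1 / 2 : ℝ) • lieBracketCLM I G (maurerCartan I (x t) (curveVelocity I S x t)) (w t) := by
  set p := x t with hp
  set φ := extChartAt I p
  have hsrc : x t ∈ (chartAt H p).source := mem_chart_source H p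
  have hy : φ p ∈ φ.target := mem_extChartAt_target p
  have hθ : DifferentiableAt ℝ (coframe I p) (φ p) :=
    (contDiffAt_coframe hy).differentiableAt (by norm_num)
  obtain ⟨ε, hε⟩ := isInvertible_coframe hy
  let V := curveVelocity I S x t
  have hF : HasDerivWithinAt (fun s ↦ φ (x s)) (toCoord I p p V) S t := by
    have h1 : mfderivWithin 𝓘(ℝ, ℝ) 𝓘(ℝ, E) (φ ∘ x) S t =
        mfderiv I 𝓘(ℝ, E) φ (x t) ∘L mfderivWithin 𝓘(ℝ, ℝ) I x S t :=
      mfderiv_comp_mfderivWithin (I' := I) _ (mdifferentiableAt_extChartAt hsrc) hx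
        hS.uniqueMDiffWithinAt
    have h2 : DifferentiableWithinAt ℝ (φ ∘ x) S t :=
      mdifferentiableWithinAt_iff_differentiableWithinAt.1
        ((mdifferentiableAt_extChartAt hsrc).comp_mdifferentiableWithinAt t hx)
    rw [← TangentBundle.continuousLinearMapAt_trivializationAt hsrc,
      mfderivWithin_eq_fderivWithin] at h1
    have h3 : toCoord I p p V = fderivWithin ℝ (φ ∘ x) S t 1 :=
      congrArg (fun L : ℝ →L[ℝ] E ↦ L 1) h1.symm
    rw [h3]
    exact h2.hasFDerivWithinAt.hasDerivWithinAt
  have hθx : HasDerivWithinAt (fun s ↦ coframe I p (φ (x s)))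
      (fderiv ℝ (coframe I p) (φ p) (toCoord I p p V)) S t :=
    HasFDerivAt.comp_hasDerivWithinAt (f := fun s ↦ φ (x s)) t hθ.hasFDerivAt hF
  have hev : ∀ᶠ s in nhdsWithin t S, x s ∈ (chartAt H p).source :=
    hx.continuousWithinAt.preimage_mem_nhdsWithin (chart_source_mem_nhds H p)
  have heq : ∀ᶠ s in nhdsWithin t S, coframe I p (φ (x s)) (toCoord I p (x s) (W s)) = w s := by
    filter_upwards [hev, self_mem_nhdsWithin] with s h1 h2
    rw [coframe_toCoord h1, hW s h2]
  have hWd : DifferentiableWithinAt ℝ (fun s ↦ toCoord I p (x s) (W s)) S t := by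
    have h1 : DifferentiableAt ℝ (ContinuousLinearMap.inverse : (E →L[ℝ] E) → E →L[ℝ] E)
        (coframe I p (φ (x t))) := by
      change DifferentiableAt ℝ _ (coframe I p (φ p))
      have : CompleteSpace E := FiniteDimensional.complete ℝ E
      rw [← hε]
      exact (contDiffAt_map_inverse (n := 1) ε).differentiableAt (by norm_num)
    have h2 : DifferentiableWithinAt ℝ (fun s ↦ (coframe I p (φ (x s))).inverse (w s)) S t :=
      (h1.comp_differentiableWithinAt t hθx.differentiableWithinAt).clm_apply
        hw.differentiableWithinAt
    have h3 : (fun s ↦ toCoord I p (x s) (W s)) =ᶠ[nhdsWithin t S]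
        fun s ↦ (coframe I p (φ (x s))).inverse (w s) := by
      filter_upwards [hev, heq] with s h1 h2
      have : φ (x s) ∈ φ.target := φ.map_source (by simpa [φ] using h1)
      rw [← h2]
      obtain ⟨ε', hε'⟩ := isInvertible_coframe this
      rw [← hε']; simp
    exact h2.congr_of_eventuallyEq h3 (h3.self_of_nhdsWithin ht)
  -- Differentiating `θ (x s) (W s) = w s` expresses `w'` by the coordinate derivative of `W`.
  have hprod := hθx.clm_apply hWd.hasDerivWithinAt
  have huniq := hS.eq_deriv S (hprod.congr_of_eventuallyEq
    (Filter.EventuallyEq.symm heq) (heq.self_of_nhdsWithin ht).symm) hw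
  have hwt : coframe I p (φ p) (toCoord I p p (W t)) = w t := heq.self_of_nhdsWithin ht
  rw [covDerivAlong, maurerCartan_ofCoord_self]
  rw [map_add, hg.christoffel_eq hy, (isInvertible_coframe hy).self_apply_inverse, hwt,
    coframe_toCoord hsrc, ← huniq]
  abel

end PseudoRiemannianMetric

end BiInvariant

/-! ### Riemannian cubics and products of one-parameter subgroups -/

section OneParameterSubgroup

variable {E : Type*} [NormedAddCommGroup E] [NormedSpace ℝ E]
  {H : Type*} [TopologicalSpace H] {I : ModelWithCorners ℝ E H}
  {G : Type*} [TopologicalSpace G] [ChartedSpace H G] [Group G]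
  {y z : ℝ → G} {A B : E}

theorem IsOneParameterSubgroup.map_zero (hy : IsOneParameterSubgroup (I := I) y A) : y 0 = 1 := by
  have := hy.map_add 0 0
  rwa [add_zero, left_eq_mul] at this

theorem IsOneParameterSubgroup.mdifferentiable (hy : IsOneParameterSubgroup (I := I) y A) :
    MDifferentiable 𝓘(ℝ, ℝ) I y := hy.contMDiff.mdifferentiable (by simp)

theorem IsOneParameterSubgroup.maurerCartanPullback_zero (hy : IsOneParameterSubgroup (I := I) y A) :
    maurerCartanPullback I y 0 1 = A :=
  (congrArg (fun X : TangentBundle I G ↦ maurerCartan I X.1 X.2) hy.generator).trans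
    (maurerCartan_one A)

variable [LieGroup I ∞ G]

/-- A right translate of a one-parameter subgroup has constant velocity in the Lie algebra, as its
restarts are left translates of it. -/
theorem IsOneParameterSubgroup.maurerCartanPullback_mul_const
    (hy : IsOneParameterSubgroup (I := I) y A) (q : G) (t : ℝ) :
    maurerCartanPullback I (fun s ↦ y s * q) t =
      maurerCartanPullback I (fun s ↦ y s * q) 0 := by
  have hd : MDifferentiable 𝓘(ℝ, ℝ) I (fun s ↦ y s * q) :=
    (mdifferentiable_mul_const q).comp hy.mdifferentiable
  have e : (fun s ↦ y s * q) = fun s ↦ y t * (fun s ↦ y s * q) (s - t) := by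
    ext s
    simp only
    rw [← mul_assoc, ← hy.map_add, add_sub_cancel]
  have hs : MDifferentiableAt 𝓘(ℝ, ℝ) I (fun s ↦ (fun s ↦ y s * q) (s - t)) t :=
    MDifferentiableAt.comp (I' := 𝓘(ℝ, ℝ)) t (hd _)
      (differentiableAt_fun_id.sub_const t).mdifferentiableAt
  have h1 := maurerCartanPullback_mul_left (y t) hs
  rw [← e] at h1
  rw [h1, maurerCartanPullback_comp (hd _) (differentiableAt_fun_id.sub_const t)]
  ext
  simp

theorem IsOneParameterSubgroup.maurerCartanPullback_one
    (hy : IsOneParameterSubgroup (I := I) y A) (t : ℝ) :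
    maurerCartanPullback I y t 1 = A := by
  have h := hy.maurerCartanPullback_mul_const 1 t
  simp only [mul_one] at h
  rw [h, hy.maurerCartanPullback_zero]

variable [FiniteDimensional ℝ E] [I.Boundaryless]

/-- The velocity of `y z` in the Lie algebra is `a + B`, where `a` solves `a' = [a, B]`,
`a(0) = A`. Explicitly `a(t) = Ad (z t)⁻¹ A`, the first component of `f^*Θ` for
`f (s, t) = y s * z t`; its derivative comes from the structure equation, since the second component
is constantly `B`. -/
theorem exists_maurerCartanPullback_mul (hy : IsOneParameterSubgroup (I := I) y A)
    (hz : IsOneParameterSubgroup (I := I) z B) :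
    ∃ a : ℝ → E, a 0 = A ∧ (∀ t, HasDerivAt a (lieBracketCLM I G (a t) B) t) ∧
      ∀ t, maurerCartanPullback I (fun s ↦ y s * z s) t 1 = a t + B := by
  let f : ℝ × ℝ → G := fun r ↦ y r.1 * z r.2
  have hf : ContMDiff 𝓘(ℝ, ℝ × ℝ) I 2 f := by
    have h1 : ContMDiff 𝓘(ℝ, ℝ × ℝ) I ∞ (fun r : ℝ × ℝ ↦ y r.1) :=
      ContMDiff.comp (I' := 𝓘(ℝ, ℝ)) hy.contMDiff contDiff_fst.contMDiff
    have h2 : ContMDiff 𝓘(ℝ, ℝ × ℝ) I ∞ (fun r : ℝ × ℝ ↦ z r.2) :=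
      ContMDiff.comp (I' := 𝓘(ℝ, ℝ)) hz.contMDiff contDiff_snd.contMDiff
    exact (h1.mul h2).of_le ENat.LEInfty.out
  have hfd : MDifferentiable 𝓘(ℝ, ℝ × ℝ) I f := hf.mdifferentiable (by simp)
  have hsnd : ∀ s t, maurerCartanPullback I f (s, t) (0, 1) = B := by
    intro s t
    have h1 := maurerCartanPullback_comp (h := fun t : ℝ ↦ (s, t)) (r := t) (hfd _)
      (hasFDerivAt_prodMk_right s t).differentiableAt
    rw [(hasFDerivAt_prodMk_right s t).fderiv,
      maurerCartanPullback_mul_left (y s) (hz.mdifferentiable t)] at h1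
    rw [← hz.maurerCartanPullback_one t, h1]; simp
  have hfst : ∀ s t, maurerCartanPullback I f (s, t) (1, 0) =
      maurerCartanPullback I (fun s ↦ y s * z t) 0 1 := by
    intro s t
    have h1 := maurerCartanPullback_comp (h := fun s : ℝ ↦ (s, t)) (r := s) (hfd _)
      (hasFDerivAt_prodMk_left s t).differentiableAt
    rw [(hasFDerivAt_prodMk_left s t).fderiv] at h1
    rw [← hy.maurerCartanPullback_mul_const, h1]; simp
  refine ⟨fun t ↦ maurerCartanPullback I f (0, t) (1, 0), ?_, fun t ↦ ?_, fun t ↦ ?_⟩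
  · simp only [hfst, hz.map_zero, mul_one]
    exact hy.maurerCartanPullback_zero
  · obtain ⟨hd, hmc⟩ := maurerCartanPullback_structure (hf (0, t))
    have h1 : HasFDerivAt (fun t ↦ maurerCartanPullback I f (0, t) (1, 0)) _ t :=
      (HasFDerivAt.comp (f := fun t : ℝ ↦ ((0 : ℝ), t)) t hd.hasFDerivAt
        (hasFDerivAt_prodMk_right 0 t)).clm_apply (hasFDerivAt_const ((1 : ℝ), (0 : ℝ)) t)
    have h2 : HasFDerivAt (fun s ↦ maurerCartanPullback I f (s, t) (0, 1)) _ 0 :=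
      (HasFDerivAt.comp (f := fun s : ℝ ↦ (s, t)) 0 hd.hasFDerivAt
        (hasFDerivAt_prodMk_left 0 t)).clm_apply (hasFDerivAt_const ((0 : ℝ), (1 : ℝ)) 0)
    have h3 := congrArg (fun L ↦ L 1)
      (h2.unique ((hasFDerivAt_const B (0 : ℝ)).congr_of_eventuallyEq
        (Filter.Eventually.of_forall fun s ↦ hsnd s t)))
    have h4 := hmc (0, 1) (1, 0)
    simp at h3
    rw [h3, sub_zero, hsnd, ← lieBracketCLM_skew] at h4
    have h5 := h1.hasDerivAt
    simp [h4] at h5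
    exact h5
  · have h1 := maurerCartanPullback_comp (f := f) (h := fun s : ℝ ↦ (s, s)) (r := t) (hfd _)
      (differentiableAt_fun_id.prodMk differentiableAt_fun_id)
    have h2 : fderiv ℝ (fun s : ℝ ↦ (s, s)) t 1 = ((1 : ℝ), (0 : ℝ)) + ((0 : ℝ), (1 : ℝ)) := by
      rw [DifferentiableAt.fderiv_prodMk differentiableAt_fun_id differentiableAt_fun_id]; simp
    rw [show (fun s ↦ y s * z s) = fun s ↦ f (s, s) from rfl, h1, ContinuousLinearMap.comp_apply,
      h2, map_add, hsnd, hfst]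
    exact congrArg (· + B) (hfst 0 t).symm

/-- The equation of Riemannian cubics read in the Lie algebra: if `v` is the velocity of `x` there,
with successive derivatives `v₁`, `v₂`, `v₃`, the equation is `v''' + [v, v''] = 0`. The curvature
term cancels the double brackets produced by the covariant derivatives. -/
theorem PseudoRiemannianMetric.IsBiInvariant.isRiemannianCubic_iff
    {g : PseudoRiemannianMetric I G} (hg : g.IsBiInvariant) {t₀ t₁ : ℝ} (ht : t₀ < t₁) {x : ℝ → G}
    (hx : ContMDiff 𝓘(ℝ, ℝ) I ∞ x) {v v₁ v₂ v₃ : ℝ → E}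
    (hv : ∀ t, maurerCartanPullback I x t 1 = v t) (hv₁ : ∀ t, HasDerivAt v (v₁ t) t)
    (hv₂ : ∀ t, HasDerivAt v₁ (v₂ t) t) (hv₃ : ∀ t, HasDerivAt v₂ (v₃ t) t) :
    g.IsRiemannianCubic t₀ t₁ x ↔
      ∀ t ∈ Icc t₀ t₁, v₃ t + lieBracketCLM I G (v t) (v₂ t) = 0 := by
  set S := Icc t₀ t₁
  set c := lieBracketCLM I G
  have hskew : ∀ u v : E, c u v = -c v u := lieBracketCLM_skew
  have hself : ∀ u : E, c u u = 0 := lieBracketCLM_self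
  have hS : UniqueDiffOn ℝ S := uniqueDiffOn_Icc ht
  have hxd : MDifferentiable 𝓘(ℝ, ℝ) I x := hx.mdifferentiable (by simp)
  have hV : ∀ t ∈ S, maurerCartan I (x t) (curveVelocity I S x t) = v t := by
    intro t hts
    rw [← hv, curveVelocity, mfderivWithin_eq_mfderiv (hS t hts).uniqueMDiffWithinAt (hxd t)]
    rfl
  have hD : ∀ (W : ∀ t, TangentSpace I (x t)) (w w' : ℝ → E),
      (∀ t ∈ S, maurerCartan I (x t) (W t) = w t) → (∀ t, HasDerivAt w (w' t) t) →
      ∀ t ∈ S, maurerCartan I (x t) (g.covDerivAlong S x W t) =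
        w' t + (1 / 2 : ℝ) • c (v t) (w t) := by
    intro W w w' hW hw t hts
    rw [hg.maurerCartan_covDerivAlong hts (hS t hts) (hxd t).mdifferentiableWithinAt hW
      (hw t).hasDerivWithinAt, hV t hts]
  have hD1 : ∀ t ∈ S, maurerCartan I (x t)
      (g.covDerivAlong S x (curveVelocity I S x) t) = v₁ t := by
    intro t hts
    rw [hD _ _ _ hV hv₁ t hts, hself, smul_zero, add_zero]
  have hD2 := hD _ _ _ hD1 hv₂
  have hD3 := hD _ _ _ hD2 fun t ↦ (hv₃ t).add
    (((c.hasFDerivAt.comp_hasDerivAt t (hv₁ t)).clm_apply (hv₂ t)).const_smul (1 / 2 : ℝ))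
  have hk : ∀ t ∈ S, maurerCartan I (x t)
      (g.covDerivAlong S x (g.covDerivAlong S x (g.covDerivAlong S x (curveVelocity I S x))) t +
        g.curvature (x t) (g.covDerivAlong S x (curveVelocity I S x) t) (curveVelocity I S x t)
          (curveVelocity I S x t)) = v₃ t + c (v t) (v₂ t) := by
    intro t hts
    rw [map_add, hD3 t hts, hg.maurerCartan_curvature, hD1 t hts, hV t hts]
    simp only [Function.comp_apply]
    rw [hskew (lieBracketCLM I G _ _) (v t), hskew (v₁ t) (v t)]
    simp only [map_add, map_neg, map_smul, hself]
    module
  constructor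
  · rintro ⟨-, h⟩ t hts
    rw [← hk t hts, h t hts, map_zero]
  · refine fun h ↦ ⟨hx.contMDiffOn, fun t hts ↦ maurerCartan_injective (x t) ?_⟩
    rw [map_zero, ← h t hts, ← hk t hts]

end OneParameterSubgroup

theorem eq_zero_of_hasDerivAt_clm {E : Type*} [NormedAddCommGroup E] [NormedSpace ℝ E]
    (L : E →L[ℝ] E) {k : ℝ → E} (hk : ∀ t, HasDerivAt k (L (k t)) t) {s : ℝ} (hs : k s = 0)
    (t : ℝ) : k t = 0 :=
  congrFun (ODE_solution_unique_univ (v := fun _ u ↦ L u) (s := fun _ ↦ univ)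
    (f := k) (g := fun _ ↦ 0) (t₀ := s) (fun _ ↦ L.lipschitz.lipschitzOnWith)
    (fun t ↦ ⟨hk t, trivial⟩)
    (fun t ↦ ⟨by simpa using hasDerivAt_const t (0 : E), trivial⟩) hs) t


theorem mainTheorem5
    {E : Type*} [NormedAddCommGroup E] [NormedSpace ℝ E] [FiniteDimensional ℝ E]
    {H : Type*} [TopologicalSpace H] (I : ModelWithCorners ℝ E H) [I.Boundaryless]
    {G : Type*} [TopologicalSpace G] [ChartedSpace H G] [Group G] [LieGroup I ∞ G]
    (g : PseudoRiemannianMetric I G) (hg : g.IsBiInvariant)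
    (t₀ t₁ : ℝ) (ht : t₀ < t₁)
    (A B : GroupLieAlgebra I G) (y z : ℝ → G)
    (hy : IsOneParameterSubgroup y A) (hz : IsOneParameterSubgroup z B) :
    g.IsRiemannianCubic t₀ t₁ (fun t ↦ y t * z t) ↔ ⁅⁅⁅B, A⁆, A⁆, B⁆ = 0 := by
  obtain ⟨a, ha0, ha, hv⟩ := exists_maurerCartanPullback_mul hy hz
  set c := lieBracketCLM I G
  -- `A'` and `B'` are `A` and `B` regarded as vectors of the model space, which has a norm.
  obtain ⟨A', hA'⟩ : ∃ A' : E, A' = A := ⟨A, rfl⟩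
  obtain ⟨B', hB'⟩ : ∃ B' : E, B' = B := ⟨B, rfl⟩
  have hbr : (⁅⁅⁅B, A⁆, A⁆, B⁆ : GroupLieAlgebra I G) = c (c (c B' A') A') B' := by
    rw [hA', hB']; rfl
  rw [← hA'] at ha0
  rw [← hB'] at ha hv
  have hskew : ∀ u v : E, c u v = -c v u := lieBracketCLM_skew
  have hself : ∀ u : E, c u u = 0 := lieBracketCLM_self
  have hjac : ∀ u v w : E, c u (c v w) = c (c u v) w + c v (c u w) := lieBracketCLM_jacobi
  have hflip : ∀ (w : ℝ → E) (w' : E) (t : ℝ), HasDerivAt w w' t →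
      HasDerivAt (fun s ↦ c (w s) B') (c w' B') t :=
    fun w w' t h ↦ (c.flip B').hasFDerivAt.comp_hasDerivAt t h
  have hm₁ : ∀ t, HasDerivAt (fun s ↦ c (a s) B') (c (c (a t) B') B') t :=
    fun t ↦ hflip _ _ t (ha t)
  have hm₂ : ∀ t, HasDerivAt (fun s ↦ c (c (a s) B') B') (c (c (c (a t) B') B') B') t :=
    fun t ↦ hflip _ _ t (hm₁ t)
  -- `k` solves `k' = [k, B]`, as `[·, B]` is a derivation; so it vanishes everywhere or nowhere.
  let k : ℝ → E := fun t ↦ c (a t) (c (c (a t) B') B')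
  have hk : ∀ t, HasDerivAt k (c.flip B' (k t)) t := by
    intro t
    have h' : HasDerivAt k _ t := (c.hasFDerivAt.comp_hasDerivAt t (ha t)).clm_apply (hm₂ t)
    convert h' using 1
    have h := hjac B' (a t) (c (c (a t) B') B')
    rw [hskew B' (a t), hskew B' (c (c (a t) B') B'), hskew B' (c (a t) _)] at h
    simp only [map_neg, neg_apply] at h
    rw [ContinuousLinearMap.flip_apply, ← neg_inj, h]
    simp only [Function.comp_apply]
    abel
  have hk0 : (∀ t ∈ Icc t₀ t₁, k t = 0) ↔ k 0 = 0 :=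
    ⟨fun h ↦ eq_zero_of_hasDerivAt_clm _ hk (h t₀ (left_mem_Icc.2 ht.le)) 0,
      fun h t _ ↦ eq_zero_of_hasDerivAt_clm _ hk h t⟩
  have hk0' : k 0 = c (c (c B' A') A') B' := by
    simp only [k, ha0]
    rw [hjac, hself, add_zero, hskew A' (c A' B'), hskew A' B']
    simp
  refine (hg.isRiemannianCubic_iff ht (hy.contMDiff.mul hz.contMDiff) hv
    (fun t ↦ (ha t).add_const B') hm₁ hm₂).trans ?_
  refine Iff.trans ?_ (hk0.trans (by rw [hk0']; exact Eq.congr hbr.symm rfl))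
  refine forall₂_congr fun t _ ↦ ?_
  rw [map_add, add_apply, hskew B' (c (c (a t) B') B'), add_comm, neg_add_cancel_right]
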